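/- Let $G$ be a compactly generated, totally disconnected, locally compact group. A \emph{Cayley--Abels graph} for $G$ is a connected, locally finite graph on which $G$ acts vertex-transitively by automorphisms with compact, open vertex stabilizers; $\mathrm{md}(G)$ denotes the minimal degree of a Cayley--Abels graph for $G$. The \emph{local action} of $G$ on a Cayley--Abels graph $\Gamma$ of degree $d$ is the permutation group $L\le S_d$ (well defined up to conjugation) induced by a vertex stabilizer $G_\alpha$ on the $d$ neighbours of $\alpha$. A \emph{composition series} of a profinite group $P$ is a finite or countable descending subnormal series $P=P_0\triangleright P_1\triangleright P_2\triangleright\cdots$ of closed subgroups with trivial intersection and simple successive quotients, and these quotients are, up to isomorphism, \emph{composition factors} of $P$. The \emph{local simple content} of a totally disconnected, locally compact group is the set of isomorphism classes of finite simple groups that are a composition factor of every compact open subgroup. A \emph{subquotient} of a group is a quotient of one of its subgroups. (1) Let $\Gamma$ be a Cayley--Abels graph for $G$ of degree $d$, let $K$ be the kernel of the action of $G$ on $\Gamma$, and let $L\le S_d$ be the local action. If $A$ is an element of the local simple content of $G/K$ (with the quotient topology), then $A$ is a subquotient of a point stabilizer of $L$, i.e.\ there are $i\in\{1,\dots,d\}$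 and $N\triangleleft H\le L_i$ with $H/N\cong A$; in particular, $A$ is a subquotient of $S_{d-1}$. Consequently, the local simple content of $G/K$ is finite. (2) Assume that $G$ has no nontrivial compact normal subgroup. Then the local simple content of $G$ is finite. If moreover $G$ is not the trivial group, then there is a smallest $n\ge 0$ such that the symmetric group $S_n$ contains every element of the local simple content of $G$ as a subquotient, and $\mathrm{md}(G)>n$. -/

import Mathlib

universe u v w

/-- The topological group `G` is compactly generated: some compact subset generates it. -/
def IsCompactlyGeneratedGroup (G : Type u) [Group G] [TopologicalSpace G] : Prop :=
  ∃ S : Set G, IsCompact S ∧ Subgroup.closure S = ⊤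

/-- `A` is (isomorphic to) a subquotient of `B`: a quotient `H ⧸ N` of a subgroup `H` of `B` by a
normal subgroup `N` of `H`. -/
def IsSubquotient (A : Type v) [Group A] (B : Type w) [Group B] : Prop :=
  ∃ (H : Subgroup B) (N : Subgroup H) (_ : N.Normal), Nonempty (A ≃* H ⧸ N)

section CayleyAbels

variable (G : Type u) [Group G] {V : Type v} [MulAction G V]

/-- The action of the topological group `G` on the vertex set makes `Γ` a Cayley–Abels graph for
`G`: `G` acts by automorphisms, vertex-transitively and with compact open vertex stabilizers on the
connected, locally finite graph `Γ`. -/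
structure IsCayleyAbelsGraph [TopologicalSpace G] (Γ : SimpleGraph V) : Prop where
  adj_smul_iff : ∀ (g : G) (a b : V), Γ.Adj (g • a) (g • b) ↔ Γ.Adj a b
  connected : Γ.Connected
  finite_neighborSet : ∀ a : V, (Γ.neighborSet a).Finite
  transitive : MulAction.IsPretransitive G V
  isCompact_stabilizer : ∀ a : V, IsCompact (MulAction.stabilizer G a : Set G)
  isOpen_stabilizer : ∀ a : V, IsOpen (MulAction.stabilizer G a : Set G)

/-- All vertices of `Γ` have (finite) degree `d`. -/
def HasDegree (Γ : SimpleGraph V) (d : ℕ) : Prop :=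
  ∀ a : V, (Γ.neighborSet a).Finite ∧ (Γ.neighborSet a).ncard = d

/-- The permutation group `G_a ^ Γ(a)` on the set `Γ(a)` of neighbours of the vertex `a` that the
stabilizer `G_a` induces. -/
def localActionAt (Γ : SimpleGraph V) (a : V) : Subgroup (Equiv.Perm (Γ.neighborSet a)) where
  carrier := {σ | ∃ g : G, g • a = a ∧ ∀ b : Γ.neighborSet a, ((σ b : V)) = g • (b : V)}
  one_mem' := ⟨1, one_smul G a, fun b => (one_smul G (b : V)).symm⟩
  mul_mem' := by
    rintro σ τ ⟨g, hga, hg⟩ ⟨h, hha, hh⟩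
    refine ⟨g * h, by rw [mul_smul, hha, hga], fun b => ?_⟩
    rw [Equiv.Perm.mul_apply, hg, hh, mul_smul]
  inv_mem' := by
    rintro σ ⟨g, hga, hg⟩
    refine ⟨g⁻¹, by rw [inv_smul_eq_iff, hga], fun b => ?_⟩
    rw [eq_inv_smul_iff, ← hg, ← Equiv.Perm.mul_apply, mul_inv_cancel, Equiv.Perm.one_apply]

/-- The permutation group `L ≤ S_d` is the local action of `G` on the `d`-regular graph `Γ`:
after numbering the neighbours of some vertex `a` by `Fin d`, the group `L` is the permutation
group that `G_a` induces on these neighbours. (For a vertex-transitive action the local actions at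
different vertices are isomorphic as permutation groups, and `L` is determined up to conjugation
in `S_d`.) -/
def IsLocalAction (Γ : SimpleGraph V) {d : ℕ} (L : Subgroup (Equiv.Perm (Fin d))) : Prop :=
  ∃ (a : V) (e : Γ.neighborSet a ≃ Fin d),
    ∀ σ : Equiv.Perm (Γ.neighborSet a), e.permCongr σ ∈ L ↔ σ ∈ localActionAt G Γ a

end CayleyAbels

/-- The minimal degree `md(G)` of a Cayley–Abels graph for `G`. (By transitivity the vertex set of
such a graph is in bijection with a coset space of `G`, so vertex sets in the universe of `G`
suffice.) -/
noncomputable def minimalDegree (G : Type u) [Group G] [TopologicalSpace G] : ℕ :=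
  sInf {d : ℕ | ∃ (V : Type u) (_ : MulAction G V) (Γ : SimpleGraph V),
    IsCayleyAbelsGraph G Γ ∧ HasDegree Γ d}

/-- A composition series of a (profinite) topological group `P`: a countable descending subnormal
series `P = P_0 ▷ P_1 ▷ P_2 ▷ ⋯` of closed subgroups with trivial intersection and simple
successive quotients. A finite series, one that reaches the trivial group, is continued by the
trivial group; only the quotients before that point are composition factors. -/
structure ProfiniteCompositionSeries (P : Type u) [Group P] [TopologicalSpace P] where
  /-- The terms of the series. -/
  term : ℕ → Subgroup P
  term_zero : term 0 = ⊤
  isClosed_term : ∀ i, IsClosed (term i : Set P)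
  term_succ_le : ∀ i, term (i + 1) ≤ term i
  normal_succ : ∀ i, ((term (i + 1)).subgroupOf (term i)).Normal
  iInf_term : ⨅ i, term i = ⊥
  simple_quotient : ∀ i, term i ≠ ⊥ →
    letI := normal_succ i
    IsSimpleGroup (term i ⧸ (term (i + 1)).subgroupOf (term i))

attribute [instance] ProfiniteCompositionSeries.normal_succ

/-- The group `A` is a composition factor of the (profinite) topological group `P`: it is
isomorphic to one of the successive quotients of a composition series of `P`. -/
def IsCompositionFactor (A : Type v) [Group A] (P : Type u) [Group P] [TopologicalSpace P] :
    Prop :=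
  ∃ (s : ProfiniteCompositionSeries P) (i : ℕ), s.term i ≠ ⊥ ∧
    Nonempty (A ≃* s.term i ⧸ (s.term (i + 1)).subgroupOf (s.term i))

/-- The group `A` is an element of the local simple content of the topological group `G`: it is a
finite simple group and a composition factor of every compact open subgroup of `G`. -/
def InLocalSimpleContent (A : Type v) [Group A] (G : Type u) [Group G] [TopologicalSpace G] :
    Prop :=
  Finite A ∧ IsSimpleGroup A ∧
    ∀ U : Subgroup G, IsCompact (U : Set G) → IsOpen (U : Set G) → IsCompositionFactor A U

/-- Isomorphism of finite groups. -/
def finiteGroupSetoid : Setoid FiniteGrp.{0} where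
  r A B := Nonempty (A ≃* B)
  iseqv :=
    { refl := fun A => ⟨MulEquiv.refl A⟩
      symm := fun ⟨e⟩ => ⟨e.symm⟩
      trans := fun ⟨e⟩ ⟨f⟩ => ⟨e.trans f⟩ }

/-- The local simple content of `G`, as a set of isomorphism classes of finite groups. -/
def localSimpleContent (G : Type u) [Group G] [TopologicalSpace G] :
    Set (Quotient finiteGroupSetoid) :=
  {c | ∃ A : FiniteGrp.{0}, Quotient.mk finiteGroupSetoid A = c ∧ InLocalSimpleContent A G}

/-! The fixator `P` of a star is compact and open, so `A` is a composition factor of its image in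
`G/K`; pulling back the relevant term of the series gives a compact group `X` mapping onto `A` with
open kernel. Enlarge a set `F` of vertices, one neighbour `v` at a time, and let `M` be the subgroup
of `X` fixing all stars around `F`. If `M` maps onto `A` and `v` is adjacent to `w ∈ F`, then `M`
fixes `v` and `w`, so it acts on the neighbours of `v` inside a point stabilizer of the local
action. The kernel of this action has normal image in the simple group `A`: either trivial, and `A`
is a subquotient of that point stabilizer, or all of `A`, and `F` can grow
(`starFixator_insert_or_isSubquotient`). Growth cannot go on over all finite sets, by compactness of
`X`. For (2), the kernel of the action is compact and normal, hence trivial, and a graph of minimal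
degree gives the bound. -/

/-! ### Subquotients -/

theorem IsSubquotient.of_surjective {A : Type*} {B : Type*} {M : Type*} [Group A] [Group B]
    [Group M] (φ : M →* A) (hφ : Function.Surjective φ) (α : M →* B) (h : α.ker ≤ φ.ker) :
    IsSubquotient A B := by
  have hker : α.rangeRestrict.ker ≤ φ.ker := by rwa [α.ker_rangeRestrict]
  -- `φ` factors through the image of `α`, which is the required subgroup of `B`.
  let ψ : α.range →* A := α.rangeRestrict.liftOfSurjective α.rangeRestrict_surjective ⟨φ, hker⟩
  have hψ : Function.Surjective ψ := by
    intro y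
    obtain ⟨x, rfl⟩ := hφ y
    exact ⟨α.rangeRestrict x,
      α.rangeRestrict.liftOfRightInverse_comp_apply _ _ ⟨φ, hker⟩ x⟩
  exact ⟨α.range, ψ.ker, inferInstance,
    ⟨(QuotientGroup.quotientKerEquivOfSurjective ψ hψ).symm⟩⟩

theorem IsSubquotient.of_injective {A : Type*} {B : Type*} {C : Type*} [Group A] [Group B]
    [Group C] (h : IsSubquotient A B) (f : B →* C) (hf : Function.Injective f) :
    IsSubquotient A C := by
  obtain ⟨H, N, hN, ⟨e⟩⟩ := h
  refine .of_surjective (e.symm.toMonoidHom.comp (QuotientGroup.mk' N))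
    (e.symm.surjective.comp (QuotientGroup.mk'_surjective N)) (f.comp H.subtype) ?_
  have : (f.comp H.subtype).ker = ⊥ :=
    (MonoidHom.ker_eq_bot_iff _).2 (hf.comp H.subtype_injective)
  rw [this]
  exact bot_le

/-- The isomorphism classes of subquotients of a finite group form a finite set. -/
theorem finite_setOf_isSubquotient (B : Type) [Group B] [Finite B] :
    {c : Quotient finiteGroupSetoid | ∃ A : FiniteGrp.{0},
      Quotient.mk finiteGroupSetoid A = c ∧ IsSubquotient A B}.Finite := by
  let F : (Σ H : Subgroup B, {N : Subgroup H // N.Normal}) → Quotient finiteGroupSetoid :=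
    fun p => haveI := p.2.2; Quotient.mk _ (FiniteGrp.of (p.1 ⧸ p.2.1))
  refine (Set.finite_range F).subset ?_
  rintro _ ⟨A, rfl, H, N, hN, ⟨e⟩⟩
  exact ⟨⟨H, N, hN⟩, Quotient.sound ⟨e.symm⟩⟩

theorem isSubquotient_perm_of_stabilizer {A : Type*} [Group A] {d : ℕ}
    {L : Subgroup (Equiv.Perm (Fin d))} {i : Fin d}
    (h : IsSubquotient A (MulAction.stabilizer L i)) :
    IsSubquotient A (Equiv.Perm (Fin (d - 1))) := by
  have hfix : ∀ σ : MulAction.stabilizer L i, ((σ : L) : Equiv.Perm (Fin d)) i = i := fun σ => σ.2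
  have hiff : ∀ (σ : MulAction.stabilizer L i) (x : Fin d),
      ((σ : L) : Equiv.Perm (Fin d)) x ≠ i ↔ x ≠ i := by
    intro σ x
    exact ((σ : L) : Equiv.Perm (Fin d)).injective.ne_iff' (hfix σ)
  let r : MulAction.stabilizer L i →* Equiv.Perm {x : Fin d // x ≠ i} :=
    { toFun := fun σ => ((σ : L) : Equiv.Perm (Fin d)).subtypePerm (hiff σ)
      map_one' := by ext; rfl
      map_mul' := fun σ τ => by ext; rfl }
  have hr : Function.Injective r := by
    intro σ τ hστ
    apply Subtype.ext
    apply Subtype.ext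
    ext x
    by_cases hx : x = i
    · rw [hx, hfix, hfix]
    · have := congrArg (fun p : Equiv.Perm {x : Fin d // x ≠ i} => ((p ⟨x, hx⟩ : Fin d) : ℕ)) hστ
      exact this
  -- The subtraction does not truncate: `i : Fin d` forces `d ≥ 1`.
  have hcard : Fintype.card {x : Fin d // x ≠ i} = d - 1 := by
    rw [Fintype.card_subtype_compl]
    simp
  let e : {x : Fin d // x ≠ i} ≃ Fin (d - 1) := Fintype.equivFinOfCardEq hcard
  exact h.of_injective (e.permCongrHom.toMonoidHom.comp r) (e.permCongrHom.injective.comp hr)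

/-! ### Local actions at varying vertices -/

section LocalAction

variable {G : Type u} [Group G] {V : Type v} [MulAction G V] {Γ : SimpleGraph V}

/-- The action of a vertex stabilizer on the neighbours of the vertex, as a homomorphism to the
local action. -/
def stabilizerToLocalAction (hadj : ∀ (g : G) (a b : V), Γ.Adj (g • a) (g • b) ↔ Γ.Adj a b)
    (v : V) : MulAction.stabilizer G v →* localActionAt G Γ v where
  toFun g := ⟨(MulAction.toPerm (g : G)).subtypePerm fun b => by
      have := hadj g v b
      rwa [MulAction.mem_stabilizer_iff.1 g.2] at this, g, g.2, fun _ => rfl⟩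
  map_one' := by ext; simp
  map_mul' g h := by ext x; exact mul_smul (g : G) (h : G) (x : V)

theorem stabilizerToLocalAction_apply
    (hadj : ∀ (g : G) (a b : V), Γ.Adj (g • a) (g • b) ↔ Γ.Adj a b)
    (v : V) (g : MulAction.stabilizer G v) (b : Γ.neighborSet v) :
    (((stabilizerToLocalAction hadj v g : Equiv.Perm (Γ.neighborSet v)) b : Γ.neighborSet v) : V) =
      (g : G) • (b : V) := rfl

/-- Over a vertex-transitive graph the numbering in a local action can start at any vertex. -/
theorem IsLocalAction.exists_equiv
    (hadj : ∀ (g : G) (a b : V), Γ.Adj (g • a) (g • b) ↔ Γ.Adj a b)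
    [MulAction.IsPretransitive G V] {d : ℕ} {L : Subgroup (Equiv.Perm (Fin d))}
    (hL : IsLocalAction G Γ L) (v : V) :
    ∃ e : Γ.neighborSet v ≃ Fin d, ∀ σ ∈ localActionAt G Γ v, e.permCongr σ ∈ L := by
  obtain ⟨a, e, he⟩ := hL
  obtain ⟨g, rfl⟩ := MulAction.exists_smul_eq G a v
  let t : Γ.neighborSet a ≃ Γ.neighborSet (g • a) :=
    (MulAction.toPerm g).subtypeEquiv fun b => (hadj g a b).symm
  have ht : ∀ b, ((t b : Γ.neighborSet (g • a)) : V) = g • (b : V) := fun _ => rfl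
  refine ⟨t.symm.trans e, ?_⟩
  rintro σ ⟨h, hh, hσ⟩
  -- If `h` induces `σ` at `g • a`, its conjugate by `g⁻¹` induces the transported permutation at
  -- `a`.
  have key : t.symm.permCongr σ ∈ localActionAt G Γ a := by
    refine ⟨g⁻¹ * h * g, by rw [mul_smul, mul_smul, hh, inv_smul_smul], fun b => ?_⟩
    rw [mul_smul, mul_smul, eq_inv_smul_iff, ← ht, ← ht, ← hσ]
    simp [Equiv.permCongr_apply]
  have := (he _).2 key
  convert this using 1
  ext x
  simp [Equiv.permCongr_apply]

theorem IsLocalAction.isSubquotient_stabilizer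
    (hadj : ∀ (g : G) (a b : V), Γ.Adj (g • a) (g • b) ↔ Γ.Adj a b)
    [MulAction.IsPretransitive G V] {d : ℕ} {L : Subgroup (Equiv.Perm (Fin d))}
    (hL : IsLocalAction G Γ L) {A : Type*} [Group A] {v : V} (b : Γ.neighborSet v)
    (h : IsSubquotient A (MulAction.stabilizer (localActionAt G Γ v) b)) :
    ∃ i : Fin d, IsSubquotient A (MulAction.stabilizer L i) := by
  obtain ⟨e, he⟩ := hL.exists_equiv hadj v
  have hb : ∀ σ : MulAction.stabilizer (localActionAt G Γ v) b,
      ((σ : localActionAt G Γ v) : Equiv.Perm (Γ.neighborSet v)) b = b := fun σ => σ.2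
  let f : MulAction.stabilizer (localActionAt G Γ v) b →* MulAction.stabilizer L (e b) :=
    { toFun := fun σ => ⟨⟨e.permCongr ((σ : localActionAt G Γ v) : Equiv.Perm _), he _ σ.1.2⟩, by
        rw [MulAction.mem_stabilizer_iff]
        change e.permCongr ((σ : localActionAt G Γ v) : Equiv.Perm _) (e b) = e b
        rw [Equiv.permCongr_apply, Equiv.symm_apply_apply, hb]⟩
      map_one' := Subtype.ext (Subtype.ext (map_one e.permCongrHom))
      map_mul' := fun σ τ => Subtype.ext (Subtype.ext (map_mul e.permCongrHom _ _)) }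
  refine ⟨e b, h.of_injective f fun σ τ hστ => Subtype.ext (Subtype.ext ?_)⟩
  exact e.permCongr.injective
    (congrArg (fun x : MulAction.stabilizer L (e b) => ((x : L) : Equiv.Perm (Fin d))) hστ)

/-- A numbering of the neighbours of a vertex of degree `d` yields a local action. -/
theorem HasDegree.exists_isLocalAction {d : ℕ} (hd : HasDegree Γ d) (a : V) :
    ∃ L : Subgroup (Equiv.Perm (Fin d)), IsLocalAction G Γ L := by
  have := (hd a).1.to_subtype
  have hcard : Nat.card (Γ.neighborSet a) = d := (hd a).2
  let e : Γ.neighborSet a ≃ Fin d := Finite.equivFinOfCardEq hcard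
  refine ⟨(localActionAt G Γ a).map e.permCongrHom.toMonoidHom, a, e, fun σ => ?_⟩
  exact Subgroup.mem_map_iff_mem e.permCongrHom.injective

end LocalAction

/-! ### Simple factors seen in point stabilizers -/

section Factor

variable {G : Type u} [Group G] {V : Type v} [MulAction G V] {Γ : SimpleGraph V}

/-- The elements of `X` that, acting through `j`, fix the vertices in `F` and all their
neighbours. -/
def starFixator (Γ : SimpleGraph V) {X : Type*} [Group X] (j : X →* G) (F : Set V) :
    Subgroup X where
  carrier := {x | ∀ v ∈ F, j x • v = v ∧ ∀ b, Γ.Adj v b → j x • b = b}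
  one_mem' := by simp
  mul_mem' := by
    intro x y hx hy v hv
    refine ⟨?_, fun b hb => ?_⟩
    · rw [map_mul, mul_smul, (hy v hv).1, (hx v hv).1]
    · rw [map_mul, mul_smul, (hy v hv).2 b hb, (hx v hv).2 b hb]
  inv_mem' := by
    intro x hx v hv
    refine ⟨?_, fun b hb => ?_⟩
    · rw [map_inv, inv_smul_eq_iff, (hx v hv).1]
    · rw [map_inv, inv_smul_eq_iff, (hx v hv).2 b hb]

theorem mem_starFixator {X : Type*} [Group X] {j : X →* G} {F : Set V} {x : X} :
    x ∈ starFixator Γ j F ↔ ∀ v ∈ F, j x • v = v ∧ ∀ b, Γ.Adj v b → j x • b = b := Iff.rfl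

/-- Exhibits the fixator as an intersection of vertex stabilizers, from which its topology is read
off. -/
theorem coe_starFixator {X : Type*} [Group X] (j : X →* G) (F : Set V) :
    (starFixator Γ j F : Set X) =
      ⋂ v ∈ F, j ⁻¹' ((MulAction.stabilizer G v : Set G) ∩
        ⋂ b ∈ Γ.neighborSet v, (MulAction.stabilizer G b : Set G)) := by
  ext x
  simp [mem_starFixator]

/-- If the fixator of the stars around `F` surjects onto the simple group `A`, and the fixator of
the stars around `F ∪ {v}` does not, then `A` is a subquotient of a point stabilizer of the local
action at `v`. -/
theorem starFixator_insert_or_isSubquotient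
    (hadj : ∀ (g : G) (a b : V), Γ.Adj (g • a) (g • b) ↔ Γ.Adj a b)
    {A : Type*} [Group A] [IsSimpleGroup A] {X : Type*} [Group X] (j : X →* G) (φ : X →* A)
    {F : Set V} (hF : (starFixator Γ j F).map φ = ⊤) {v w : V} (hw : w ∈ F) (hvw : Γ.Adj v w) :
    (starFixator Γ j (insert v F)).map φ = ⊤ ∨
      IsSubquotient A (MulAction.stabilizer (localActionAt G Γ v)
        (⟨w, hvw⟩ : Γ.neighborSet v)) := by
  let M := starFixator Γ j F
  -- `v` is a neighbour of `w ∈ F`, so `M` already fixes it.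
  let ρ : M →* MulAction.stabilizer G v :=
    (j.comp M.subtype).codRestrict _ fun x => (x.2 w hw).2 v hvw.symm
  have hρ : ∀ x : M, ((ρ x : MulAction.stabilizer G v) : G) = j x := fun _ => rfl
  let α : M →* MulAction.stabilizer (localActionAt G Γ v) (⟨w, hvw⟩ : Γ.neighborSet v) :=
    ((stabilizerToLocalAction hadj v).comp ρ).codRestrict _ fun x => by
      rw [MulAction.mem_stabilizer_iff]
      exact Subtype.ext (x.2 w hw).1
  have hφ : Function.Surjective (φ.comp M.subtype) := by
    intro y
    obtain ⟨x, hx, rfl⟩ : y ∈ (starFixator Γ j F).map φ := hF ▸ Subgroup.mem_top y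
    exact ⟨⟨x, hx⟩, rfl⟩
  have hker : ∀ x ∈ α.ker, (x : X) ∈ starFixator Γ j (insert v F) := by
    rintro x hx u (rfl | hu)
    · refine ⟨(ρ x).2, fun b hb => ?_⟩
      have h1 : stabilizerToLocalAction hadj u (ρ x) = 1 := congrArg Subtype.val hx
      rw [← hρ, ← stabilizerToLocalAction_apply hadj u (ρ x) ⟨b, hb⟩, h1]
      rfl
    · exact x.2 u hu
  have hN : (α.ker.map (φ.comp M.subtype)).Normal := α.normal_ker.map _ hφ
  rcases hN.eq_bot_or_eq_top with h | h
  · right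
    exact .of_surjective _ hφ α (by rwa [Subgroup.map_eq_bot_iff] at h)
  · left
    rw [eq_top_iff, ← h]
    rintro _ ⟨x, hx, rfl⟩
    exact ⟨x, hker x hx, rfl⟩

/-- A finite simple quotient of a compact group acting on the graph and fixing a star is a
subquotient of a point stabilizer in some local action, provided that the elements that act
trivially have trivial image. -/
theorem exists_isSubquotient_stabilizer_localActionAt [TopologicalSpace G]
    [IsTopologicalGroup G] (hΓ : IsCayleyAbelsGraph G Γ) {A : Type*} [Group A] [IsSimpleGroup A]
    {X : Type*} [Group X] [TopologicalSpace X] [CompactSpace X] (j : X →* G) (hj : Continuous j)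
    (φ : X →* A) (hφ : Function.Surjective φ) (hopen : IsOpen (φ.ker : Set X))
    (hfaithful : ∀ x, (∀ v : V, j x • v = v) → φ x = 1) (a : V)
    (ha : ∀ x, x ∈ starFixator Γ j {a}) :
    ∃ (v : V) (b : Γ.neighborSet v),
      IsSubquotient A (MulAction.stabilizer (localActionAt G Γ v) b) := by
  by_contra! hcon
  have step : ∀ {F : Set V} {v w : V}, (starFixator Γ j F).map φ = ⊤ → w ∈ F → Γ.Adj v w →
      (starFixator Γ j (insert v F)).map φ = ⊤ := fun hF hw hvw =>
    (starFixator_insert_or_isSubquotient hΓ.adj_smul_iff j φ hF hw hvw).resolve_right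
      (hcon _ _)
  have walk : ∀ {w v : V}, Γ.Walk w v → ∀ F : Set V, w ∈ F → (starFixator Γ j F).map φ = ⊤ →
      -- A distant vertex is reached only by adding all vertices of a walk to it.
      ∃ F', F ⊆ F' ∧ v ∈ F' ∧ (starFixator Γ j F').map φ = ⊤ := by
    intro w v p
    induction p with
    | nil => exact fun F hw hF => ⟨F, subset_rfl, hw, hF⟩
    | cons h p ih =>
      intro F hw hF
      obtain ⟨F', h1, h2, h3⟩ := ih _ (Set.mem_insert _ F) (step hF hw h.symm)
      exact ⟨F', (Set.subset_insert _ _).trans h1, h2, h3⟩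
  have fin : ∀ T : Finset V, ∃ F : Set V, a ∈ F ∧ ↑T ⊆ F ∧ (starFixator Γ j F).map φ = ⊤ := by
    classical
    intro T
    induction T using Finset.induction_on with
    | empty =>
      refine ⟨{a}, rfl, by simp, ?_⟩
      rw [eq_top_iff]
      intro y _
      obtain ⟨x, rfl⟩ := hφ y
      exact ⟨x, ha x, rfl⟩
    | insert v T _ ih =>
      obtain ⟨F, haF, hTF, hF⟩ := ih
      obtain ⟨p⟩ := hΓ.connected.preconnected a v
      obtain ⟨F', h1, h2, h3⟩ := walk p F haF hF
      refine ⟨F', h1 haF, ?_, h3⟩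
      rw [Finset.coe_insert]
      exact Set.insert_subset h2 (hTF.trans h1)
  have hclosed : ∀ v : V, IsClosed (j ⁻¹' (MulAction.stabilizer G v : Set G)) := fun v =>
    (Subgroup.isClosed_of_isOpen _ (hΓ.isOpen_stabilizer v)).preimage hj
  -- Each element outside the kernel moves some vertex; by compactness finitely many vertices
  -- suffice to detect them all.
  obtain ⟨T, hT⟩ := (hopen.isClosed_compl.isCompact).elim_finite_subcover
    (fun v : V => (j ⁻¹' (MulAction.stabilizer G v : Set G))ᶜ)
    (fun v => (hclosed v).isOpen_compl) (by
      intro x hx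
      by_contra hx'
      simp only [Set.mem_iUnion, Set.mem_compl_iff, not_exists, not_not] at hx'
      exact hx (hfaithful x hx'))
  obtain ⟨F, -, hTF, hF⟩ := fin T
  obtain ⟨y, hy⟩ := exists_ne (1 : A)
  obtain ⟨x, hx, rfl⟩ : y ∈ (starFixator Γ j F).map φ := hF ▸ Subgroup.mem_top y
  have hxT := hT (show x ∈ (φ.ker : Set X)ᶜ from hy)
  simp only [Set.mem_iUnion, Set.mem_compl_iff] at hxT
  obtain ⟨v, hv, hxv⟩ := hxT
  exact hxv (hx v (hTF hv)).1

/-- The elements of the local simple content of a group `Q` that is the image of `G` under an open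
homomorphism killing the elements that act trivially. -/
theorem InLocalSimpleContent.exists_isSubquotient_stabilizer [TopologicalSpace G]
    [IsTopologicalGroup G] (hΓ : IsCayleyAbelsGraph G Γ) {d : ℕ}
    {L : Subgroup (Equiv.Perm (Fin d))} (hL : IsLocalAction G Γ L)
    {Q : Type*} [Group Q] [TopologicalSpace Q] (f : G →* Q) (hf : Continuous f)
    (hfo : IsOpenMap f) (hker : ∀ g : G, (∀ v : V, g • v = v) → f g = 1)
    {A : Type*} [Group A] (hA : InLocalSimpleContent A Q) :
    ∃ i : Fin d, IsSubquotient A (MulAction.stabilizer L i) := by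
  obtain ⟨hfin, hsimple, hA⟩ := hA
  obtain ⟨a, -⟩ := id hL
  let P : Subgroup G := starFixator Γ (MonoidHom.id G) {a}
  have hP : (P : Set G) = (MulAction.stabilizer G a : Set G) ∩
      ⋂ b ∈ Γ.neighborSet a, (MulAction.stabilizer G b : Set G) := by
    simp [P, coe_starFixator]
  have hPo : IsOpen (P : Set G) := by
    rw [hP]
    exact (hΓ.isOpen_stabilizer a).inter
      ((hΓ.finite_neighborSet a).isOpen_biInter fun b _ => hΓ.isOpen_stabilizer b)
  have hPc : IsCompact (P : Set G) :=
    (hΓ.isCompact_stabilizer a).of_isClosed_subset (Subgroup.isClosed_of_isOpen _ hPo)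
      (hP ▸ Set.inter_subset_left)
  obtain ⟨s, i, -, ⟨e⟩⟩ := hA (P.map f) (hPc.image hf) (hfo _ hPo)
  let ψ : P →* P.map f := f.subgroupMap P
  have hψc : Continuous ψ := (hf.comp continuous_subtype_val).subtype_mk _
  have hψs : Function.Surjective ψ := f.subgroupMap_surjective P
  -- Lifting to `P` keeps a genuine action on the graph, which the image in `Q` need not have.
  let X : Subgroup P := (s.term i).comap ψ
  have : CompactSpace P := isCompact_iff_compactSpace.1 hPc
  have : CompactSpace X :=
    isCompact_iff_compactSpace.1 ((s.isClosed_term i).preimage hψc).isCompact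
  let χ : X →* s.term i := ψ.subgroupComap (s.term i)
  have hχ : Function.Surjective χ := by
    rintro ⟨y, hy⟩
    obtain ⟨x, rfl⟩ := hψs y
    exact ⟨⟨x, hy⟩, rfl⟩
  have hχc : Continuous χ := (hψc.comp continuous_subtype_val).subtype_mk _
  let φ : X →* A :=
    (e.symm.toMonoidHom.comp (QuotientGroup.mk' ((s.term (i + 1)).subgroupOf (s.term i)))).comp χ
  have hφ : Function.Surjective φ :=
    (e.symm.surjective.comp (QuotientGroup.mk'_surjective _)).comp hχ
  have hφker : ∀ x, φ x = 1 ↔ ((χ x : s.term i) : P.map f) ∈ s.term (i + 1) := by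
    intro x
    change e.symm (QuotientGroup.mk' _ (χ x)) = 1 ↔ _
    rw [EmbeddingLike.map_eq_one_iff, QuotientGroup.mk'_apply, QuotientGroup.eq_one_iff,
      Subgroup.mem_subgroupOf]
  have hclosed : IsClosed (φ.ker : Set X) := by
    have : (φ.ker : Set X) =
        (fun x => ((χ x : s.term i) : P.map f)) ⁻¹' (s.term (i + 1) : Set (P.map f)) := by
      ext x
      exact hφker x
    rw [this]
    exact (s.isClosed_term (i + 1)).preimage (continuous_subtype_val.comp hχc)
  -- Finiteness of `A` turns the closed kernel into an open one.
  have : φ.ker.FiniteIndex := Subgroup.finiteIndex_ker φ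
  have hopen := φ.ker.isOpen_of_isClosed_of_finiteIndex hclosed
  have := hΓ.transitive
  obtain ⟨v, b, hvb⟩ := exists_isSubquotient_stabilizer_localActionAt hΓ
    (P.subtype.comp X.subtype) (continuous_subtype_val.comp continuous_subtype_val) φ hφ hopen
    (fun x hx => (hφker x).2 (by
      have : ((χ x : s.term i) : P.map f) = 1 := Subtype.ext (hker _ hx)
      rw [this]
      exact one_mem _)) a (fun x => x.1.2)
  exact hL.isSubquotient_stabilizer hΓ.adj_smul_iff b hvb

end Factor

/-! ### Existence of Cayley–Abels graphs -/

section Existence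

open Pointwise Topology

/-- **Van Dantzig's theorem**, in the form that a compact open subgroup exists. -/
theorem exists_isCompact_isOpen_subgroup (G : Type*) [Group G] [TopologicalSpace G]
    [IsTopologicalGroup G] [LocallyCompactSpace G] [TotallyDisconnectedSpace G] :
    ∃ U : Subgroup G, IsCompact (U : Set G) ∧ IsOpen (U : Set G) := by
  obtain ⟨C, hC, hC1⟩ := exists_compact_mem_nhds (1 : G)
  obtain ⟨W, hW, h1W, hWC⟩ := (loc_compact_Haus_tot_disc_of_zero_dim (H := G)).mem_nhds_iff.1 hC1
  have hWc : IsCompact W := hC.of_isClosed_subset hW.1 hWC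
  obtain ⟨N, hN, hNW⟩ := compact_open_separated_mul_left hWc hW.2 subset_rfl
  -- Left translations preserving the compact open set `W`; as `1 ∈ W`, they all lie in `W`.
  let U : Subgroup G := MulAction.stabilizer G W
  have hUo : IsOpen (U : Set G) := by
    refine Subgroup.isOpen_of_mem_nhds (g := 1) U
      (Filter.mem_of_superset (Filter.inter_mem hN (inv_mem_nhds_one G hN)) ?_)
    rintro g ⟨hg, hg'⟩
    refine MulAction.mem_stabilizer_iff.2 (subset_antisymm ?_ ?_)
    · rintro _ ⟨x, hx, rfl⟩
      exact hNW (Set.mul_mem_mul hg hx)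
    · intro x hx
      rw [Set.mem_smul_set_iff_inv_smul_mem]
      exact hNW (Set.mul_mem_mul hg' hx)
  refine ⟨U, hWc.of_isClosed_subset (Subgroup.isClosed_of_isOpen _ hUo) fun g hg => ?_, hUo⟩
  have h : g • W = W := hg
  rw [← h]
  exact ⟨1, h1W, mul_one g⟩

/-- The Cayley–Abels graph on the cosets of `U` given by the set `S`. -/
def cosetGraph {G : Type*} [Group G] (U : Subgroup G) (S : Set G) : SimpleGraph (G ⧸ U) :=
  SimpleGraph.fromRel fun x y => ∃ g : G, ∃ s ∈ S, x = (g : G ⧸ U) ∧ y = ((g * s : G) : G ⧸ U)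

theorem cosetGraph_adj_smul_iff {G : Type*} [Group G] (U : Subgroup G) (S : Set G) (g : G)
    (a b : G ⧸ U) : (cosetGraph U S).Adj (g • a) (g • b) ↔ (cosetGraph U S).Adj a b := by
  have key : ∀ (g : G) (a b : G ⧸ U), (cosetGraph U S).Adj a b →
      (cosetGraph U S).Adj (g • a) (g • b) := by
    rintro g a b ⟨hne, h⟩
    refine ⟨(MulAction.injective g).ne hne, h.imp ?_ ?_⟩ <;>
    · rintro ⟨k, s, hs, rfl, rfl⟩
      exact ⟨g * k, s, hs, rfl, by rw [mul_assoc]; rfl⟩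
  refine ⟨fun h => ?_, key g a b⟩
  simpa using key g⁻¹ _ _ h

/-- The `x` such that `gU` and `gxU` are joined for every `g` form a subgroup containing `S`;
quantifying over `g` gives closure under products and inverses. -/
theorem cosetGraph_connected {G : Type*} [Group G] (U : Subgroup G) {S : Set G}
    (hS : Subgroup.closure S = ⊤) : (cosetGraph U S).Connected := by
  have hstep : ∀ g : G, ∀ s ∈ S,
      (cosetGraph U S).Reachable (g : G ⧸ U) ((g * s : G) : G ⧸ U) := by
    intro g s hs
    by_cases h : (g : G ⧸ U) = ((g * s : G) : G ⧸ U)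
    · rw [h]
    · exact SimpleGraph.Adj.reachable ⟨h, Or.inl ⟨g, s, hs, rfl, rfl⟩⟩
  have hmul : ∀ x : G, ∀ g : G,
      (cosetGraph U S).Reachable (g : G ⧸ U) ((g * x : G) : G ⧸ U) := by
    intro x
    have hx : x ∈ Subgroup.closure S := hS ▸ Subgroup.mem_top x
    induction hx using Subgroup.closure_induction with
    | mem s hs => exact fun g => hstep g s hs
    | one => intro g; rw [mul_one]
    | mul x y _ _ hx hy =>
      intro g
      rw [← mul_assoc]
      exact (hx g).trans (hy _)
    | inv x _ hx =>
      intro g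
      have := hx (g * x⁻¹)
      rw [inv_mul_cancel_right] at this
      exact this.symm
  have : Nonempty (G ⧸ U) := ⟨((1 : G) : G ⧸ U)⟩
  refine ⟨fun a b => ?_⟩
  obtain ⟨x, rfl⟩ := QuotientGroup.mk_surjective a
  obtain ⟨y, rfl⟩ := QuotientGroup.mk_surjective b
  have := hmul (x⁻¹ * y) x
  rwa [mul_inv_cancel_left] at this

/-- Neighbours of `hU` lie in the images of the compact sets `hUS` and `hUS⁻¹` in the discrete space
`G ⧸ U`, so they are finite in number. Stabilizers are conjugates of `U`. -/
theorem isCayleyAbelsGraph_cosetGraph {G : Type*} [Group G] [TopologicalSpace G]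
    [IsTopologicalGroup G] {U : Subgroup G} (hUc : IsCompact (U : Set G))
    (hUo : IsOpen (U : Set G)) {S : Set G} (hSc : IsCompact S) (hS : Subgroup.closure S = ⊤) :
    IsCayleyAbelsGraph G (cosetGraph U S) where
  adj_smul_iff := cosetGraph_adj_smul_iff U S
  connected := cosetGraph_connected U hS
  transitive := inferInstance
  finite_neighborSet a := by
    have : DiscreteTopology (G ⧸ U) := QuotientGroup.discreteTopology hUo
    obtain ⟨h, rfl⟩ := QuotientGroup.mk_surjective a
    have hfin : ∀ T : Set G, IsCompact T →
        ((fun g : G => (g : G ⧸ U)) '' (h • (U : Set G) * T)).Finite := fun T hT =>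
      (((hUc.smul h).mul hT).image QuotientGroup.continuous_mk).finite_of_discrete
    refine ((hfin S hSc).union (hfin S⁻¹ hSc.inv)).subset ?_
    rintro b ⟨-, ⟨g, s, hs, hg, rfl⟩ | ⟨g, s, hs, rfl, hg⟩⟩
    · refine Or.inl ⟨g * s, Set.mul_mem_mul ?_ hs, rfl⟩
      rw [Set.mem_smul_set_iff_inv_smul_mem]
      exact QuotientGroup.eq.1 hg
    · refine Or.inr ⟨g, ⟨g * s, ?_, s⁻¹, Set.inv_mem_inv.2 hs, mul_inv_cancel_right g s⟩, rfl⟩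
      rw [Set.mem_smul_set_iff_inv_smul_mem]
      exact QuotientGroup.eq.1 hg
  isCompact_stabilizer a := by
    obtain ⟨h, rfl⟩ := QuotientGroup.mk_surjective a
    have : (MulAction.stabilizer G (h : G ⧸ U) : Set G) = (fun x => h * x * h⁻¹) '' (U : Set G) := by
      ext x
      rw [SetLike.mem_coe, MulAction.mem_stabilizer_iff, eq_comm]
      change (h : G ⧸ U) = ((x * h : G) : G ⧸ U) ↔ _
      rw [QuotientGroup.eq]
      constructor
      · exact fun hx => ⟨_, hx, by group⟩
      · rintro ⟨y, hy, rfl⟩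
        simpa [mul_assoc] using hy
    rw [this]
    exact hUc.image (by fun_prop)
  isOpen_stabilizer a := by
    have : DiscreteTopology (G ⧸ U) := QuotientGroup.discreteTopology hUo
    exact (isOpen_discrete ({a} : Set (G ⧸ U))).preimage
      (f := fun g : G => g • a) (by fun_prop)

theorem IsCayleyAbelsGraph.exists_hasDegree {G : Type*} [Group G] [TopologicalSpace G]
    {V : Type*} [MulAction G V] {Γ : SimpleGraph V} (hΓ : IsCayleyAbelsGraph G Γ) :
    ∃ d, HasDegree Γ d := by
  obtain ⟨a⟩ := hΓ.connected.nonempty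
  refine ⟨(Γ.neighborSet a).ncard, fun b => ⟨hΓ.finite_neighborSet b, ?_⟩⟩
  have := hΓ.transitive
  obtain ⟨g, rfl⟩ := MulAction.exists_smul_eq G a b
  exact (Set.ncard_congr' ((MulAction.toPerm g).subtypeEquiv
    fun b => (hΓ.adj_smul_iff g a b).symm)).symm

/-- A compactly generated, totally disconnected, locally compact group has a Cayley–Abels graph,
and one of them has minimal degree. -/
theorem exists_isCayleyAbelsGraph_minimalDegree {G : Type u} [Group G] [TopologicalSpace G]
    [IsTopologicalGroup G] [LocallyCompactSpace G] [TotallyDisconnectedSpace G]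
    (hG : IsCompactlyGeneratedGroup G) :
    ∃ (V : Type u) (_ : MulAction G V) (Γ : SimpleGraph V),
      IsCayleyAbelsGraph G Γ ∧ HasDegree Γ (minimalDegree G) := by
  obtain ⟨S, hSc, hS⟩ := hG
  obtain ⟨U, hUc, hUo⟩ := exists_isCompact_isOpen_subgroup G
  have hΓ := isCayleyAbelsGraph_cosetGraph hUc hUo hSc hS
  obtain ⟨d, hd⟩ := hΓ.exists_hasDegree
  -- Nonemptiness matters: the infimum of the empty set would be the default `0`.
  exact Nat.sInf_mem (s := {d : ℕ | ∃ (V : Type u) (_ : MulAction G V) (Γ : SimpleGraph V),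
    IsCayleyAbelsGraph G Γ ∧ HasDegree Γ d}) ⟨d, _, _, _, hΓ, hd⟩

end Existence

/-! ### Kernel of the action and degree zero -/

section Faithful

variable {G : Type u} [Group G] [TopologicalSpace G] [IsTopologicalGroup G] {V : Type v}
  [MulAction G V] {Γ : SimpleGraph V}

/-- The kernel is an intersection of closed subgroups inside one compact stabilizer. -/
theorem IsCayleyAbelsGraph.isCompact_ker (hΓ : IsCayleyAbelsGraph G Γ) :
    IsCompact ((MulAction.toPermHom G V).ker : Set G) := by
  obtain ⟨a⟩ := hΓ.connected.nonempty
  have h : ((MulAction.toPermHom G V).ker : Set G) =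
      ⋂ v : V, (MulAction.stabilizer G v : Set G) := by
    ext g
    simp [Equiv.ext_iff]
  refine (hΓ.isCompact_stabilizer a).of_isClosed_subset ?_ ?_
  · rw [h]
    exact isClosed_iInter fun v => Subgroup.isClosed_of_isOpen _ (hΓ.isOpen_stabilizer v)
  · rw [h]
    exact Set.iInter_subset _ a

theorem HasDegree.subsingleton_of_zero (hd : HasDegree Γ 0) (hc : Γ.Connected) :
    Subsingleton V := by
  refine ⟨fun a b => ?_⟩
  obtain ⟨p⟩ := hc.preconnected a b
  cases p with
  | nil => rfl
  | @cons _ c _ h _ =>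
    have := (Set.ncard_eq_zero (hd a).1).1 (hd a).2
    exact absurd (show c ∈ Γ.neighborSet a from h) (this ▸ Set.notMem_empty c)

end Faithful

/-! ### Finiteness and the main theorem -/

theorem finite_localSimpleContent {Q : Type u} [Group Q] [TopologicalSpace Q] {n : ℕ}
    (h : ∀ A : FiniteGrp.{0}, InLocalSimpleContent A Q → IsSubquotient A (Equiv.Perm (Fin n))) :
    (localSimpleContent Q).Finite :=
  (finite_setOf_isSubquotient (Equiv.Perm (Fin n))).subset
    fun _ ⟨A, hAc, hA⟩ => ⟨A, hAc, h A hA⟩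

theorem mainTheorem3 {G : Type u} [Group G] [TopologicalSpace G] [IsTopologicalGroup G]
    [LocallyCompactSpace G] [TotallyDisconnectedSpace G] (hG : IsCompactlyGeneratedGroup G) :
    -- Cayley–Abels graphs of degree `d` with local action `L ≤ S_d`; the kernel of the action is
    -- that of the homomorphism from `G` to the permutations of the vertices
    (∀ (V : Type v) [MulAction G V] (Γ : SimpleGraph V) (d : ℕ)
        (L : Subgroup (Equiv.Perm (Fin d))),
      IsCayleyAbelsGraph G Γ → HasDegree Γ d → IsLocalAction G Γ L →
        (∀ (A : Type w) [Group A], InLocalSimpleContent A (G ⧸ (MulAction.toPermHom G V).ker) →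
          (∃ i : Fin d, IsSubquotient A (MulAction.stabilizer L i)) ∧
          IsSubquotient A (Equiv.Perm (Fin (d - 1)))) ∧
        (localSimpleContent (G ⧸ (MulAction.toPermHom G V).ker)).Finite) ∧
    -- groups without nontrivial compact normal subgroups
    ((∀ N : Subgroup G, N.Normal → IsCompact (N : Set G) → N = ⊥) →
      (localSimpleContent G).Finite ∧
      (Nontrivial G →
        ∃ n : ℕ, IsLeast {n : ℕ | ∀ A : FiniteGrp.{0}, InLocalSimpleContent A G →
            IsSubquotient A (Equiv.Perm (Fin n))} n ∧
          n < minimalDegree G)) := by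
  refine ⟨fun V _ Γ d L hΓ hd hL => ?_, fun hN => ?_⟩
  · have hker : ∀ g : G, (∀ v : V, g • v = v) →
        QuotientGroup.mk' (MulAction.toPermHom G V).ker g = 1 := fun g hg =>
      (QuotientGroup.eq_one_iff g).2 (Equiv.ext hg)
    refine ⟨fun A _ hA => ?_, finite_localSimpleContent (n := d - 1) fun A hA => ?_⟩
    · obtain ⟨i, hi⟩ := hA.exists_isSubquotient_stabilizer hΓ hL
        (QuotientGroup.mk' (MulAction.toPermHom G V).ker) QuotientGroup.continuous_mk
        QuotientGroup.isOpenMap_coe hker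
      exact ⟨⟨i, hi⟩, isSubquotient_perm_of_stabilizer hi⟩
    · obtain ⟨i, hi⟩ := hA.exists_isSubquotient_stabilizer hΓ hL
        (QuotientGroup.mk' (MulAction.toPermHom G V).ker) QuotientGroup.continuous_mk
        QuotientGroup.isOpenMap_coe hker
      exact isSubquotient_perm_of_stabilizer hi
  · obtain ⟨V, _, Γ, hΓ, hd⟩ := exists_isCayleyAbelsGraph_minimalDegree hG
    obtain ⟨a⟩ := hΓ.connected.nonempty
    obtain ⟨L, hL⟩ := hd.exists_isLocalAction (G := G) a
    have hbot := hN _ (MulAction.toPermHom G V).normal_ker hΓ.isCompact_ker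
    have hker : ∀ g : G, (∀ v : V, g • v = v) → MonoidHom.id G g = 1 := fun g hg => by
      have : g ∈ (MulAction.toPermHom G V).ker := Equiv.ext hg
      rwa [hbot, Subgroup.mem_bot] at this
    have hsub : ∀ A : FiniteGrp.{0}, InLocalSimpleContent A G →
        IsSubquotient A (Equiv.Perm (Fin (minimalDegree G - 1))) := fun A hA => by
      obtain ⟨i, hi⟩ := hA.exists_isSubquotient_stabilizer hΓ hL (MonoidHom.id G) continuous_id
        IsOpenMap.id hker
      exact isSubquotient_perm_of_stabilizer hi
    refine ⟨finite_localSimpleContent hsub, fun hnt => ?_⟩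
    -- Needed for `minimalDegree G - 1 < minimalDegree G`. In degree zero there is a single vertex,
    -- so the faithful action makes `G` trivial.
    have hpos : minimalDegree G ≠ 0 := by
      intro h0
      rw [h0] at hd
      have := hd.subsingleton_of_zero hΓ.connected
      obtain ⟨g, hg⟩ := exists_ne (1 : G)
      exact hg (hker g fun v => Subsingleton.elim _ _)
    classical
    have hex : ∃ n : ℕ, n ∈ {n : ℕ | ∀ A : FiniteGrp.{0}, InLocalSimpleContent A G →
        IsSubquotient A (Equiv.Perm (Fin n))} := ⟨_, hsub⟩
    refine ⟨Nat.find hex, ⟨Nat.find_spec hex, fun m hm => Nat.find_min' hex hm⟩, ?_⟩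
    have := Nat.find_min' hex hsub
    omega
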